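/- **Setting.** Let $S$ be a finite non-empty set of silos and $U$ a finite set of users. A database $D=(D_s)_{s\in S}$ consists, for every silo $s$ and user $u$, of finitely many (possibly no) records, in numbered places. Two datasets of a silo are record-neighbours if they differ in at most one record (added, removed or replaced); two databases are user-neighbours if they differ in the records of at most one user. A mechanism $M$ is $(\epsilon,\delta)$-ULDP if $\Pr[M(D)\in Z]\le e^{\epsilon}\Pr[M(D')\in Z]+\delta$ for all user-neighbours $D,D'$ and all measurable $Z$. A mechanism $M$ on silo datasets is (record-level) $(\alpha,\rho)$-RDP if $D_\alpha(M(D)\|M(D'))\le\rho$ for all record-neighbours $D,D'$, where $D_\alpha(P\|Q)=\frac1{\alpha-1}\log\mathbb E_{x\sim Q}\big[(\tfrac{dP}{dQ}(x))^\alpha\big]$ (and $+\infty$ if $P\not\ll Q$). **Algorithm.** ULDP-GROUP-$k$ gets flags $b^s_{u,i}\in\{0,1\}$, independent of the data and the same in all rounds, with $\sum_{s,i}b^s_{u,i}\le k$ for every user $u$. Starting from a random or fixed model $\theta_0\in\mathbb R^d$, in each round $t=0,\dots,T-1$ every silo $s$ independently removes from $D_s$ all records with flag $0$, runs DP-SGD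 from $\theta_t$ on the remaining ones to get a model $x^s_t$, and the server sets $\theta_{t+1}=\theta_t+\eta_g\frac1{|S|}\sum_{s}(x^s_t-\theta_t)$. Here a DP-SGD call consists of $Q$ iterations $$x\leftarrow x-\frac{\eta_l}{L}\Big(\sum_{\xi\in B}\frac{\nabla_x F(x;\xi)}{\max(1,\|\nabla_x F(x;\xi)\|_2/C)}+\mathcal N(0,\sigma^2C^2 I)\Big),$$ with $B$ a fresh Poisson sample of the records with rate $\gamma$, clipping bound $C>0$, noise multiplier $\sigma\ge0$ and lot size $L>0$. **Theorem.** Let $k$ be a power of $2$, $0<\delta<1$ and $\alpha>2^{k+1}$. For every silo $s$ let the local DP-SGD subroutine be record-level $(\alpha,\rho_s)$-RDP over the $T$ rounds: the sequence of the initial models and the outputs of its $T$ calls on the same silo dataset is $(\alpha,\rho_s)$-RDP, whatever the (possibly randomized) rule by which the initial model of a call is chosen from the initial models and outputs of the earlier calls. Put $\rho=\max_{s\in S}\rho_s$. Then ULDP-GROUP-$k$, run for $T$ rounds, satisfies $$\Big(3^k\rho+\log\frac{\alpha/2^k-1}{\alpha/2^k}-\frac{\log\delta+\log(\alpha/2^k)}{\alpha/2^k-1},\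 \delta\Big)\text{-ULDP},$$ both when its output is the final global model $\theta_T$ and when its output is the whole sequence $\theta_0,\dots,\theta_T$ of global models. -/

import Mathlib

open MeasureTheory ProbabilityTheory

noncomputable section

namespace ULDP

/-! ### Rényi divergence and the privacy notions -/

/-- Rényi divergence `D_α(P ‖ Q) = (α - 1)⁻¹ log E_{x ∼ Q} [(dP/dQ)(x) ^ α]` of order `α > 1`;
it is `+∞` if `P` is not absolutely continuous with respect to `Q`. -/
def renyiDiv {Z : Type*} [MeasurableSpace Z] (α : ℝ) (P Q : Measure Z) : EReal :=
  open Classical in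
  if P ≪ Q then (((α - 1)⁻¹ : ℝ) : EReal) * ENNReal.log (∫⁻ x, (P.rnDeriv Q x) ^ α ∂Q) else ⊤

/-- `(α, ρ)`-RDP of the randomized mechanism `M` (a database is sent to the law of the output) for
the neighbouring relation `nbr`. -/
def IsRDP {𝒟 Z : Type*} [MeasurableSpace Z] (nbr : 𝒟 → 𝒟 → Prop) (M : 𝒟 → Measure Z)
    (α ρ : ℝ) : Prop :=
  ∀ D D' : 𝒟, nbr D D' → renyiDiv α (M D) (M D') ≤ (ρ : EReal)

/-- `(ε, δ)`-DP of the randomized mechanism `M` for the neighbouring relation `nbr`. -/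
def IsDP {𝒟 Z : Type*} [MeasurableSpace Z] (nbr : 𝒟 → 𝒟 → Prop) (M : 𝒟 → Measure Z)
    (ε δ : ℝ) : Prop :=
  ∀ D D' : 𝒟, nbr D D' → ∀ A : Set Z, MeasurableSet A →
    M D A ≤ ENNReal.ofReal (Real.exp ε) * M D' A + ENNReal.ofReal δ

/-! ### Databases -/

/-- The dataset of one silo: `D u i` is the `i`-th record of user `u` in this silo, or `none` if
there is no such record. Records have type `X`, and `m` bounds the number of records that a user
can have in a silo. -/
abbrev SiloData (U : Type*) (m : ℕ) (X : Type*) := U → Fin m → Option X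

/-- A database across the silos. -/
abbrev Database (S U : Type*) (m : ℕ) (X : Type*) := S → SiloData U m X

/-- Two datasets of a silo differ in at most one record (added, removed or replaced). -/
def RecordNeighbor {U X : Type*} {m : ℕ} (D D' : SiloData U m X) : Prop :=
  {p : U × Fin m | D p.1 p.2 ≠ D' p.1 p.2}.Subsingleton

/-- Two databases across the silos differ in at most one user's records. -/
def UserNeighbor {S U X : Type*} {m : ℕ} (D D' : Database S U m X) : Prop :=
  {u : U | ∃ s, D s u ≠ D' s u}.Subsingleton

/-- `(ε, δ)`-ULDP. -/
def IsULDP {S U X Z : Type*} {m : ℕ} [MeasurableSpace Z] (M : Database S U m X → Measure Z)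
    (ε δ : ℝ) : Prop :=
  IsDP UserNeighbor M ε δ

/-- Keep the records whose flag is set, remove the others. -/
def filterData {U X : Type*} {m : ℕ} (b : U → Fin m → Bool) (D : SiloData U m X) :
    SiloData U m X :=
  fun u i => if b u i then D u i else none

/-! ### DP-SGD -/

/-- The space of model parameters. -/
abbrev Model (d : ℕ) := EuclideanSpace ℝ (Fin d)

/-- Parameters of DP-SGD. -/
structure SGDParams where
  /-- noise multiplier -/
  σ : ℝ
  /-- clipping bound -/
  C : ℝ
  /-- learning rate -/
  η : ℝ
  /-- sampling rate -/
  γ : unitInterval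
  /-- lot size, by which the noisy sum of the gradients is divided -/
  L : ℝ
  /-- number of iterations in one call -/
  Q : ℕ
  σ_nonneg : 0 ≤ σ
  C_pos : 0 < C
  L_pos : 0 < L

/-- Clipping of a vector to norm at most `C`. -/
def clip {d : ℕ} (C : ℝ) (v : Model d) : Model d := (max 1 (‖v‖ / C))⁻¹ • v

/-- The clipped gradient of the loss `F` at the model `θ` for one record; an absent record
contributes nothing. -/
def clippedGrad {d : ℕ} {X : Type*} (F : Model d → X → ℝ) (C : ℝ) (θ : Model d) :
    Option X → Model d
  | none => 0
  | some x => clip C (gradient (fun θ' => F θ' x) θ)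

open Classical in
/-- The update of one iteration of DP-SGD at the model `θ`, for the sampled lot `ω.1` and the
standard Gaussian vector `ω.2`:
`θ - η · (1 / L) (∑_{r in the lot} clipped gradient of r + σ C ω.2)`. -/
def sgdUpdate {d : ℕ} {U X : Type*} [Fintype U] {m : ℕ} (F : Model d → X → ℝ) (P : SGDParams)
    (D : SiloData U m X) (θ : Model d) (ω : Set (U × Fin m) × Model d) : Model d :=
  θ - P.η • (P.L)⁻¹ •
    ((∑ p : U × Fin m, if p ∈ ω.1 then clippedGrad F P.C θ (D p.1 p.2) else 0)
      + (P.σ * P.C) • ω.2)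

theorem measurable_clippedGrad {d : ℕ} {X : Type*} (F : Model d → X → ℝ) (C : ℝ)
    (o : Option X) : Measurable fun θ => clippedGrad F C θ o := by
  cases o with
  | none => exact measurable_const
  | some x =>
    have h : Measurable fun θ => gradient (fun θ' => F θ' x) θ :=
      (InnerProductSpace.toDual ℝ (Model d)).symm.continuous.measurable.comp
        (measurable_fderiv ℝ (fun θ' => F θ' x))
    show Measurable fun θ => (max 1 (‖gradient (fun θ' => F θ' x) θ‖ / C))⁻¹ •
      gradient (fun θ' => F θ' x) θ
    fun_prop

theorem measurable_sgdUpdate {d : ℕ} {U X : Type*} [Fintype U] {m : ℕ} (F : Model d → X → ℝ)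
    (P : SGDParams) (D : SiloData U m X) :
    Measurable fun q : Model d × (Set (U × Fin m) × Model d) => sgdUpdate F P D q.1 q.2 := by
  classical
  have h : ∀ p : U × Fin m, Measurable fun q : Model d × (Set (U × Fin m) × Model d) =>
      if p ∈ q.2.1 then clippedGrad F P.C q.1 (D p.1 p.2) else 0 := by
    intro p
    refine Measurable.ite ?_ ((measurable_clippedGrad F P.C _).comp measurable_fst)
      measurable_const
    have h1 : MeasurableSet {B : Set (U × Fin m) | p ∈ B} :=
      measurableSet_setOfPred.2 (measurable_set_mem p)
    exact (measurable_fst.comp measurable_snd) h1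
  have h2 := Finset.measurable_fun_sum Finset.univ fun p _ => h p
  unfold sgdUpdate
  fun_prop

/-- The law of the randomness of one iteration: a Poisson-sampled lot, which contains each
present record independently with probability `γ`, and an independent standard Gaussian vector. -/
def sgdNoise (d : ℕ) {U X : Type*} {m : ℕ} (P : SGDParams) (D : SiloData U m X) :
    Measure (Set (U × Fin m) × Model d) :=
  (setBernoulli {p : U × Fin m | (D p.1 p.2).isSome} P.γ).prod (stdGaussian (Model d))

instance {d : ℕ} {U X : Type*} {m : ℕ} (P : SGDParams) (D : SiloData U m X) :
    IsProbabilityMeasure (sgdNoise d P D) := by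
  unfold sgdNoise; infer_instance

/-- One iteration of DP-SGD on the dataset `D`, as a kernel from the current to the next model. -/
def sgdStep {d : ℕ} {U X : Type*} [Fintype U] {m : ℕ} (F : Model d → X → ℝ) (P : SGDParams)
    (D : SiloData U m X) : Kernel (Model d) (Model d) :=
  (Kernel.id ×ₖ Kernel.const (Model d) (sgdNoise d P D)).map
    (fun q => sgdUpdate F P D q.1 q.2)

instance {d : ℕ} {U X : Type*} [Fintype U] {m : ℕ} (F : Model d → X → ℝ) (P : SGDParams)
    (D : SiloData U m X) : IsMarkovKernel (sgdStep F P D) :=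
  Kernel.IsMarkovKernel.map _ (measurable_sgdUpdate F P D)

/-- `n` iterations of DP-SGD. -/
def sgdIter {d : ℕ} {U X : Type*} [Fintype U] {m : ℕ} (F : Model d → X → ℝ) (P : SGDParams)
    (D : SiloData U m X) : ℕ → Kernel (Model d) (Model d)
  | 0 => Kernel.id
  | n + 1 => sgdStep F P D ∘ₖ sgdIter F P D n

instance {d : ℕ} {U X : Type*} [Fintype U] {m : ℕ} (F : Model d → X → ℝ) (P : SGDParams)
    (D : SiloData U m X) (n : ℕ) : IsMarkovKernel (sgdIter F P D n) := by
  induction n with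
  | zero => unfold sgdIter; infer_instance
  | succ n ih => unfold sgdIter; infer_instance

/-- A call of DP-SGD: the kernel that sends the initial model to the law of the model after `Q`
iterations. -/
def dpsgd {d : ℕ} {U X : Type*} [Fintype U] {m : ℕ} (F : Model d → X → ℝ) (P : SGDParams)
    (D : SiloData U m X) : Kernel (Model d) (Model d) :=
  sgdIter F P D P.Q

instance {d : ℕ} {U X : Type*} [Fintype U] {m : ℕ} (F : Model d → X → ℝ) (P : SGDParams)
    (D : SiloData U m X) : IsMarkovKernel (dpsgd F P D) := by
  unfold dpsgd; infer_instance

/-! ### The local subroutine of a silo over all rounds -/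

theorem measurable_fin_snoc {E : Type*} [MeasurableSpace E] (t : ℕ) :
    Measurable fun p : (Fin t → E) × E => (Fin.snoc p.1 p.2 : Fin (t + 1) → E) := by
  refine measurable_pi_iff.2 fun i => ?_
  induction i using Fin.lastCases with
  | last => simpa using measurable_snd
  | cast i =>
    simp only [Fin.snoc_castSucc]
    exact (measurable_pi_apply i).comp measurable_fst

/-- A rule for the choice of the initial models of the successive calls of a local subroutine:
the initial model of call `t` may depend, possibly in a randomized way, on the initial models and
the outputs of the calls `0, …, t - 1`. -/
abbrev Rule (E : Type*) [MeasurableSpace E] := ∀ t : ℕ, Kernel (Fin t → E × E) E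

/-- The law of the pairs (initial model, output) of `T` successive calls of the local subroutine
`κ`, where the initial models are chosen by the rule `A`. -/
def transcript {E : Type*} [MeasurableSpace E] (A : Rule E) (κ : Kernel E E) :
    (T : ℕ) → Measure (Fin T → E × E)
  | 0 => Measure.dirac Fin.elim0
  | T + 1 => (transcript A κ T ⊗ₘ (A T ⊗ₖ Kernel.prodMkLeft (Fin T → E × E) κ)).map
      fun p => Fin.snoc p.1 p.2

instance {E : Type*} [MeasurableSpace E] (A : Rule E) [∀ t, IsMarkovKernel (A t)]
    (κ : Kernel E E) [IsMarkovKernel κ] (T : ℕ) : IsProbabilityMeasure (transcript A κ T) := by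
  induction T with
  | zero => unfold transcript; infer_instance
  | succ T ih =>
    unfold transcript
    exact Measure.isProbabilityMeasure_map (measurable_fin_snoc T).aemeasurable

/-- DP-SGD, called in `T` rounds on the same dataset of a silo, satisfies record-level
`(α, ρ)`-RDP, whatever the rule by which the initial model of a round is chosen from what
happened in the earlier rounds. -/
def LocalDPSGDIsRDP {d : ℕ} (U : Type*) {X : Type*} [Fintype U] (m : ℕ) (F : Model d → X → ℝ)
    (P : SGDParams) (T : ℕ) (α ρ : ℝ) : Prop :=
  ∀ (A : Rule (Model d)) [∀ t, IsMarkovKernel (A t)],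
    IsRDP RecordNeighbor (fun D : SiloData U m X => transcript A (dpsgd F P D) T) α ρ

/-! ### The algorithm ULDP-GROUP-k -/

/-- The kernel under which the coordinates are independent, with laws given by the `κ s`. -/
def piKernel {S α β : Type*} [Fintype S] [MeasurableSpace α] [MeasurableSpace β]
    (κ : S → Kernel α β) [∀ s, IsMarkovKernel (κ s)] : Kernel α (S → β) where
  toFun a := Measure.pi fun s => κ s a
  measurable' := by
    refine Measurable.measure_of_isPiSystem_of_isProbabilityMeasure
      (S := Set.pi Set.univ '' Set.pi Set.univ fun _ : S => {s : Set β | MeasurableSet s})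
      generateFrom_pi.symm isPiSystem_pi ?_
    rintro _ ⟨s, hs, rfl⟩
    simp only [Measure.pi_pi]
    exact Finset.measurable_fun_prod _ fun i _ => Kernel.measurable_coe _ (hs i (Set.mem_univ i))

instance {S α β : Type*} [Fintype S] [MeasurableSpace α] [MeasurableSpace β]
    (κ : S → Kernel α β) [∀ s, IsMarkovKernel (κ s)] : IsMarkovKernel (piKernel κ) :=
  ⟨fun a => by show IsProbabilityMeasure (Measure.pi fun s => κ s a); infer_instance⟩

/-- The procedure of a silo in one round: starting from the global model `θ`, run DP-SGD on the
filtered dataset and return the difference between its result and `θ`. -/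
def client {d : ℕ} {U X : Type*} [Fintype U] {m : ℕ} (F : Model d → X → ℝ) (P : SGDParams)
    (b : U → Fin m → Bool) (D : SiloData U m X) : Kernel (Model d) (Model d) :=
  (Kernel.id ×ₖ dpsgd F P (filterData b D)).map fun q => q.2 - q.1

instance {d : ℕ} {U X : Type*} [Fintype U] {m : ℕ} (F : Model d → X → ℝ) (P : SGDParams)
    (b : U → Fin m → Bool) (D : SiloData U m X) : IsMarkovKernel (client F P b D) :=
  Kernel.IsMarkovKernel.map _ (by fun_prop)

/-- One round: all silos run their procedure independently from the same global model `θ`, and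
the server moves to `θ + ηg (1 / |S|) ∑ s, Δ s`. -/
def round {d : ℕ} {S U X : Type*} [Fintype S] [Fintype U] {m : ℕ} (F : Model d → X → ℝ)
    (P : S → SGDParams) (ηg : ℝ) (b : S → U → Fin m → Bool) (D : Database S U m X) :
    Kernel (Model d) (Model d) :=
  (Kernel.id ×ₖ piKernel fun s => client F (P s) (b s) (D s)).map
    fun q => q.1 + ηg • (Fintype.card S : ℝ)⁻¹ • ∑ s, q.2 s

instance {d : ℕ} {S U X : Type*} [Fintype S] [Fintype U] {m : ℕ} (F : Model d → X → ℝ)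
    (P : S → SGDParams) (ηg : ℝ) (b : S → U → Fin m → Bool) (D : Database S U m X) :
    IsMarkovKernel (round F P ηg b D) :=
  Kernel.IsMarkovKernel.map _ (by fun_prop)

/-- ULDP-GROUP-k: the law of the global models `θ 0, …, θ T` of `T` rounds, where `θ 0` has law
`μ₀`. The flags `b` are the same in all rounds. -/
def uldpGroup {d : ℕ} {S U X : Type*} [Fintype S] [Fintype U] {m : ℕ} (F : Model d → X → ℝ)
    (P : S → SGDParams) (ηg : ℝ) (b : S → U → Fin m → Bool) (μ₀ : Measure (Model d))
    (D : Database S U m X) : (T : ℕ) → Measure (Fin (T + 1) → Model d)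
  | 0 => μ₀.map fun θ _ => θ
  | T + 1 => (uldpGroup F P ηg b μ₀ D T ⊗ₘ
      (round F P ηg b D).comap (fun h : Fin (T + 1) → Model d => h (Fin.last T))
        (measurable_pi_apply _)).map fun p => Fin.snoc p.1 p.2

instance {d : ℕ} {S U X : Type*} [Fintype S] [Fintype U] {m : ℕ} (F : Model d → X → ℝ)
    (P : S → SGDParams) (ηg : ℝ) (b : S → U → Fin m → Bool) (μ₀ : Measure (Model d))
    [IsProbabilityMeasure μ₀] (D : Database S U m X) (T : ℕ) :
    IsProbabilityMeasure (uldpGroup F P ηg b μ₀ D T) := by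
  induction T with
  | zero =>
    unfold uldpGroup
    exact Measure.isProbabilityMeasure_map (by fun_prop)
  | succ T ih =>
    unfold uldpGroup
    exact Measure.isProbabilityMeasure_map (measurable_fin_snoc _).aemeasurable

/-- The law of the final global model of ULDP-GROUP-k after `T` rounds. -/
def uldpGroupFinal {d : ℕ} {S U X : Type*} [Fintype S] [Fintype U] {m : ℕ}
    (F : Model d → X → ℝ) (P : S → SGDParams) (ηg : ℝ) (b : S → U → Fin m → Bool)
    (μ₀ : Measure (Model d)) (T : ℕ) (D : Database S U m X) : Measure (Model d) :=
  (uldpGroup F P ηg b μ₀ D T).map fun h => h (Fin.last T)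

end ULDP

end

/-!
Fix two user-neighbouring databases which differ in the records of the user `u`. Only the at most
`k` flagged records of `u` matter, so one database can be turned into the other, as far as the
algorithm can tell, by at most `k` replacements of a single record, each in a single silo `s₀`.

*One replacement.* Seen from `s₀`, the algorithm is a sequence of calls of the local subroutine on
the dataset of `s₀`. The initial model of a call is computed by the server from the initial model
and the output of the call before and from what the other silos do, and the latter depend only on
the current global model and on fresh randomness. This is a rule in the sense of `Rule`, and it
does not involve the data of `s₀`. Hence the global models are a post-processing of the transcript
of `s₀` (`uldpGroup_eq_map_transcript`), and the data-processing inequality (`RenyiBound.comp`)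
shows that one replacement costs a Rényi divergence of order `α` of at most `ρ`.

*Several replacements.* The weak triangle inequality (`RenyiBound.trans`), a case of Hölder's
inequality, joins two bounds `ρ₁`, `ρ₂` of order `2β ≥ 4` to the bound `3/2 ρ₁ + ρ₂` of order `β`.
Applied after each replacement, together with the monotonicity of the divergence in its order
(`RenyiBound.mono_order`), it gives the bound `3 ^ k ρ` of order `α / 2 ^ k`.

*Conversion.* Put `y = exp ε`. The pointwise inequality `x ≤ y + c x ^ α`, with the least possible
`c`, integrated for the density `x = dP/dQ`, turns a Rényi bound into `(ε, δ)`-indistinguishability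
(`RenyiBound.measure_le`).
-/

open scoped ENNReal

namespace ULDP

section

/-! ### Bounds on the Rényi divergence -/

/-- `D_α(P ‖ Q) ≤ ρ`, written without the logarithm: `P ≪ Q` and
`∫ (dP/dQ) ^ α dQ ≤ exp ((α - 1) ρ)`. -/
structure RenyiBound {Z : Type*} [MeasurableSpace Z] (α ρ : ℝ) (P Q : Measure Z) : Prop where
  ac : P ≪ Q
  lintegral_le : ∫⁻ x, (P.rnDeriv Q x) ^ α ∂Q ≤ ENNReal.ofReal (Real.exp ((α - 1) * ρ))

variable {Z : Type*} [MeasurableSpace Z] {P Q N : Measure Z} {α β ρ ρ' : ℝ}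

theorem RenyiBound.of_renyiDiv_le (hα : 1 < α) (h : renyiDiv α P Q ≤ (ρ : EReal)) :
    RenyiBound α ρ P Q := by
  unfold renyiDiv at h
  split_ifs at h with hac
  · refine ⟨hac, ?_⟩
    have h0 : 0 < α - 1 := by linarith
    have h1 : (((α - 1 : ℝ)) : EReal) * ((((α - 1)⁻¹ : ℝ) : EReal) *
        ENNReal.log (∫⁻ x, (P.rnDeriv Q x) ^ α ∂Q)) ≤ ((α - 1 : ℝ) : EReal) * (ρ : EReal) :=
      mul_le_mul_of_nonneg_left h (by exact_mod_cast h0.le)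
    rw [← mul_assoc, ← EReal.coe_mul, mul_inv_cancel₀ h0.ne', EReal.coe_one, one_mul,
      ← EReal.coe_mul] at h1
    rw [← ENNReal.log_le_log_iff, ENNReal.log_ofReal_of_pos (Real.exp_pos _), Real.log_exp]
    exact h1
  · simp at h

theorem RenyiBound.mono_right (hα : 1 ≤ α) (h : RenyiBound α ρ P Q) (hρ : ρ ≤ ρ') :
    RenyiBound α ρ' P Q := by
  refine ⟨h.ac, h.lintegral_le.trans (ENNReal.ofReal_le_ofReal (Real.exp_le_exp.2 ?_))⟩
  exact mul_le_mul_of_nonneg_left hρ (by linarith)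

theorem lintegral_rnDeriv_self_rpow (P : Measure Z) [IsProbabilityMeasure P] (α : ℝ) :
    ∫⁻ x, (P.rnDeriv P x) ^ α ∂P = 1 := by
  have : ∫⁻ x, (P.rnDeriv P x) ^ α ∂P = ∫⁻ _, 1 ∂P := by
    refine lintegral_congr_ae ?_
    filter_upwards [P.rnDeriv_self] with x hx
    simp [hx]
  simp [this]

theorem RenyiBound.refl (hα : 1 ≤ α) (hρ : 0 ≤ ρ) (P : Measure Z) [IsProbabilityMeasure P] :
    RenyiBound α ρ P P := by
  refine ⟨Measure.AbsolutelyContinuous.rfl, ?_⟩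
  rw [lintegral_rnDeriv_self_rpow, ENNReal.one_le_ofReal, Real.one_le_exp_iff]
  exact mul_nonneg (by linarith) hρ

theorem RenyiBound.nonneg_of_self (hα : 1 < α) [IsProbabilityMeasure P]
    (h : RenyiBound α ρ P P) : 0 ≤ ρ := by
  have h1 := h.lintegral_le
  rw [lintegral_rnDeriv_self_rpow, ENNReal.one_le_ofReal, Real.one_le_exp_iff] at h1
  exact nonneg_of_mul_nonneg_right h1 (by linarith)

/-- Change of measure: `E_Q [(dP/dQ) ^ α] = E_P [(dP/dQ) ^ (α - 1)]`. -/
theorem lintegral_rnDeriv_rpow_eq [IsProbabilityMeasure P] [IsProbabilityMeasure Q] (hα : 1 ≤ α)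
    (hac : P ≪ Q) :
    ∫⁻ x, (P.rnDeriv Q x) ^ α ∂Q = ∫⁻ x, (P.rnDeriv Q x) ^ (α - 1) ∂P := by
  rw [← lintegral_rnDeriv_mul hac
    (f := fun x => (P.rnDeriv Q x) ^ (α - 1)) (by fun_prop)]
  refine lintegral_congr fun x => ?_
  conv_lhs => rw [show α = 1 + (α - 1) by ring]
  rw [ENNReal.rpow_add_of_nonneg _ _ zero_le_one (by linarith), ENNReal.rpow_one]

/-- Jensen's inequality for the concave power `p ≤ 1`. -/
theorem lintegral_rpow_le_rpow_lintegral [IsProbabilityMeasure P] {f : Z → ℝ≥0∞}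
    (hf : AEMeasurable f P) {p : ℝ} (hp0 : 0 ≤ p) (hp1 : p ≤ 1) :
    ∫⁻ x, f x ^ p ∂P ≤ (∫⁻ x, f x ∂P) ^ p := by
  have := ENNReal.lintegral_mul_norm_pow_le hf (aemeasurable_const (b := (1 : ℝ≥0∞))) hp0
    (sub_nonneg.2 hp1) (by ring)
  simpa using this

/-- The Rényi divergence is nondecreasing in its order. -/
theorem RenyiBound.mono_order [IsProbabilityMeasure P] [IsProbabilityMeasure Q] (hβ : 1 ≤ β)
    (hβα : β ≤ α) (hα : 1 < α) (h : RenyiBound α ρ P Q) : RenyiBound β ρ P Q := by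
  refine ⟨h.ac, ?_⟩
  have h1 := h.lintegral_le
  rw [lintegral_rnDeriv_rpow_eq (by linarith) h.ac] at h1 ⊢
  have h0 : 0 < α - 1 := by linarith
  have hp0 : 0 ≤ (β - 1) / (α - 1) := div_nonneg (by linarith) h0.le
  have hp1 : (β - 1) / (α - 1) ≤ 1 := by rw [div_le_one h0]; linarith
  calc ∫⁻ x, (P.rnDeriv Q x) ^ (β - 1) ∂P
      = ∫⁻ x, ((P.rnDeriv Q x) ^ (α - 1)) ^ ((β - 1) / (α - 1)) ∂P := by
        refine lintegral_congr fun x => ?_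
        rw [← ENNReal.rpow_mul, mul_div_cancel₀ _ h0.ne']
    _ ≤ (∫⁻ x, (P.rnDeriv Q x) ^ (α - 1) ∂P) ^ ((β - 1) / (α - 1)) :=
        lintegral_rpow_le_rpow_lintegral (by fun_prop) hp0 hp1
    _ ≤ (ENNReal.ofReal (Real.exp ((α - 1) * ρ))) ^ ((β - 1) / (α - 1)) := by gcongr
    _ = ENNReal.ofReal (Real.exp ((β - 1) * ρ)) := by
        rw [ENNReal.ofReal_rpow_of_pos (Real.exp_pos _), ← Real.exp_mul]
        congr 2
        field_simp

/-- Weak triangle inequality, by the Cauchy–Schwarz inequality: the order is halved, and the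
bound for the first divergence grows by the factor `(β - 1/2) / (β - 1) ≤ 3/2`. -/
theorem RenyiBound.trans [IsProbabilityMeasure P] [IsProbabilityMeasure Q]
    [IsProbabilityMeasure N] (hβ : 2 ≤ β) (hρ : 0 ≤ ρ) (hPN : RenyiBound (2 * β) ρ P N)
    (hNQ : RenyiBound (2 * β) ρ' N Q) : RenyiBound β (3 / 2 * ρ + ρ') P Q := by
  refine ⟨hPN.ac.trans hNQ.ac, ?_⟩
  have hNQ' := (hNQ.mono_order (β := 2 * β - 1) (by linarith) (by linarith)
    (by linarith)).lintegral_le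
  have hPN' := hPN.lintegral_le
  have h1 : ∫⁻ x, N.rnDeriv Q x * (P.rnDeriv N x) ^ (2 * β) ∂Q =
      ∫⁻ x, (P.rnDeriv N x) ^ (2 * β) ∂N :=
    lintegral_rnDeriv_mul hNQ.ac (f := fun x => (P.rnDeriv N x) ^ (2 * β)) (by fun_prop)
  calc ∫⁻ x, (P.rnDeriv Q x) ^ β ∂Q
      = ∫⁻ x, (N.rnDeriv Q x * (P.rnDeriv N x) ^ (2 * β)) ^ (1 / 2 : ℝ) *
          ((N.rnDeriv Q x) ^ (2 * β - 1)) ^ (1 / 2 : ℝ) ∂Q := by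
        refine lintegral_congr_ae ?_
        filter_upwards [Measure.rnDeriv_mul_rnDeriv (κ := Q) hPN.ac] with x hx
        rw [← hx, Pi.mul_apply, ENNReal.mul_rpow_of_nonneg _ _ (by linarith : (0 : ℝ) ≤ β),
          ENNReal.mul_rpow_of_nonneg _ _ (by norm_num : (0 : ℝ) ≤ 1 / 2), ← ENNReal.rpow_mul,
          ← ENNReal.rpow_mul]
        rw [show 2 * β * (1 / 2) = β by ring, mul_right_comm,
          ← ENNReal.rpow_add_of_nonneg _ _ (by norm_num) (by linarith), mul_comm]
        congr 2
        ring
    _ ≤ (∫⁻ x, N.rnDeriv Q x * (P.rnDeriv N x) ^ (2 * β) ∂Q) ^ (1 / 2 : ℝ) *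
          (∫⁻ x, (N.rnDeriv Q x) ^ (2 * β - 1) ∂Q) ^ (1 / 2 : ℝ) :=
        ENNReal.lintegral_mul_norm_pow_le (by fun_prop) (by fun_prop) (by norm_num) (by norm_num)
          (by norm_num)
    _ ≤ (ENNReal.ofReal (Real.exp ((2 * β - 1) * ρ))) ^ (1 / 2 : ℝ) *
          (ENNReal.ofReal (Real.exp ((2 * β - 1 - 1) * ρ'))) ^ (1 / 2 : ℝ) := by
        rw [h1]; gcongr
    _ = ENNReal.ofReal (Real.exp ((β - 1 / 2) * ρ + (β - 1) * ρ')) := by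
        rw [ENNReal.ofReal_rpow_of_pos (Real.exp_pos _),
          ENNReal.ofReal_rpow_of_pos (Real.exp_pos _), ← Real.exp_mul, ← Real.exp_mul,
          ← ENNReal.ofReal_mul (Real.exp_pos _).le, ← Real.exp_add]
        congr 2
        ring
    _ ≤ ENNReal.ofReal (Real.exp ((β - 1) * (3 / 2 * ρ + ρ'))) := by
        refine ENNReal.ofReal_le_ofReal (Real.exp_le_exp.2 ?_)
        nlinarith [mul_nonneg (sub_nonneg.2 hβ) hρ]

/-! ### The data-processing inequality -/

/-- Testing the two laws after post-processing by `K` against a function `φ` of the output: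
Hölder's inequality, and Jensen's inequality for `K`. -/
theorem lintegral_rpow_comp_le {Y : Type*} [MeasurableSpace Y] [IsProbabilityMeasure P]
    [IsProbabilityMeasure Q] (K : Kernel Z Y) [IsMarkovKernel K] (hα : 1 < α) (hac : P ≪ Q)
    {φ : Y → ℝ≥0∞} (hφ : Measurable φ) :
    ∫⁻ y, φ y ^ (α - 1) ∂(K ∘ₘ P) ≤ (∫⁻ x, (P.rnDeriv Q x) ^ α ∂Q) ^ (1 / α) *
      (∫⁻ y, φ y ^ α ∂(K ∘ₘ Q)) ^ ((α - 1) / α) := by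
  have hα0 : 0 < α := by linarith
  have hp0 : 0 ≤ (α - 1) / α := div_nonneg (by linarith) hα0.le
  have hp1 : (α - 1) / α ≤ 1 := by rw [div_le_one hα0]; linarith
  have hm : Measurable fun x => ∫⁻ y, φ y ^ α ∂K x := (hφ.pow_const α).lintegral_kernel
  rw [Measure.lintegral_bind K.aemeasurable (by fun_prop),
    Measure.lintegral_bind K.aemeasurable (by fun_prop)]
  calc ∫⁻ x, ∫⁻ y, φ y ^ (α - 1) ∂K x ∂P
      ≤ ∫⁻ x, (∫⁻ y, φ y ^ α ∂K x) ^ ((α - 1) / α) ∂P := by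
        refine lintegral_mono fun x => ?_
        refine le_trans (le_of_eq ?_) (lintegral_rpow_le_rpow_lintegral (by fun_prop) hp0 hp1)
        refine lintegral_congr fun y => ?_
        rw [← ENNReal.rpow_mul, mul_div_cancel₀ _ hα0.ne']
    _ = ∫⁻ x, ((P.rnDeriv Q x) ^ α) ^ (1 / α) *
          (∫⁻ y, φ y ^ α ∂K x) ^ ((α - 1) / α) ∂Q := by
        rw [← lintegral_rnDeriv_mul hac (by fun_prop)]
        refine lintegral_congr fun x => ?_
        rw [← ENNReal.rpow_mul, mul_one_div_cancel hα0.ne', ENNReal.rpow_one]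
    _ ≤ _ := ENNReal.lintegral_mul_norm_pow_le (by fun_prop) (by fun_prop) (by positivity) hp0
        (by field_simp; ring)

/-- Data-processing inequality: a randomized post-processing does not increase the Rényi
divergence. -/
theorem RenyiBound.comp {Y : Type*} [MeasurableSpace Y] [IsProbabilityMeasure P]
    [IsProbabilityMeasure Q] (K : Kernel Z Y) [IsMarkovKernel K] (hα : 1 < α)
    (h : RenyiBound α ρ P Q) : RenyiBound α ρ (K ∘ₘ P) (K ∘ₘ Q) := by
  have hac : K ∘ₘ P ≪ K ∘ₘ Q := h.ac.comp (ae_of_all _ fun _ => Measure.AbsolutelyContinuous.rfl)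
  refine ⟨hac, le_trans ?_ h.lintegral_le⟩
  have hα0 : 0 < α := by linarith
  set g := (K ∘ₘ P).rnDeriv (K ∘ₘ Q) with hg
  have hgm : Measurable g := Measure.measurable_rnDeriv _ _
  set I := ∫⁻ x, (P.rnDeriv Q x) ^ α ∂Q with hI
  -- The density is truncated, so that the integral can be cancelled in Hölder's inequality.
  have key : ∀ n : ℕ, ∫⁻ y, (min (g y) n) ^ α ∂(K ∘ₘ Q) ≤ I := by
    intro n
    set J := ∫⁻ y, (min (g y) n) ^ α ∂(K ∘ₘ Q) with hJ
    have hφ : Measurable fun y => min (g y) (n : ℝ≥0∞) := hgm.min measurable_const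
    have hJtop : J ≠ ∞ := by
      refine ne_top_of_le_ne_top (b := ∫⁻ _, (n : ℝ≥0∞) ^ α ∂(K ∘ₘ Q)) ?_ ?_
      · simp [ENNReal.rpow_eq_top_iff, hα0.le]
      · exact lintegral_mono fun y => ENNReal.rpow_le_rpow (min_le_right _ _) hα0.le
    have h1 : J ≤ I ^ (1 / α) * J ^ ((α - 1) / α) := by
      refine le_trans ?_ (lintegral_rpow_comp_le K hα h.ac hφ)
      rw [← lintegral_rnDeriv_mul hac (by fun_prop)]
      refine lintegral_mono fun y => ?_
      show (min (g y) n) ^ α ≤ g y * (min (g y) n) ^ (α - 1)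
      conv_lhs => rw [show α = 1 + (α - 1) by ring]
      rw [ENNReal.rpow_add_of_nonneg _ _ zero_le_one (by linarith), ENNReal.rpow_one]
      gcongr
      exact min_le_left _ _
    rcases eq_or_ne J 0 with h0 | h0
    · simp [h0]
    · have hsplit : J = J ^ (1 / α) * J ^ ((α - 1) / α) := by
        rw [← ENNReal.rpow_add _ _ h0 hJtop, show 1 / α + (α - 1) / α = 1 by field_simp; ring,
          ENNReal.rpow_one]
      have h2 : J ^ (1 / α) * J ^ ((α - 1) / α) ≤ I ^ (1 / α) * J ^ ((α - 1) / α) :=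
        hsplit ▸ h1
      have h3 := (ENNReal.mul_le_mul_iff_left
        (ENNReal.rpow_pos (pos_iff_ne_zero.2 h0) hJtop).ne'
        (ENNReal.rpow_ne_top_of_nonneg (div_nonneg (by linarith) hα0.le) hJtop)).1 h2
      exact (ENNReal.rpow_le_rpow_iff (by positivity)).1 h3
  have hsup : ∀ y, g y ^ α = ⨆ n : ℕ, (min (g y) n) ^ α := by
    intro y
    have h1 : g y = ⨆ n : ℕ, min (g y) (n : ℝ≥0∞) := by
      rw [← inf_iSup_eq, ENNReal.iSup_natCast, inf_top_eq]
    conv_lhs => rw [h1]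
    exact (ENNReal.orderIsoRpow α hα0).map_iSup _
  simp_rw [hsup]
  rw [lintegral_iSup (fun n => (hgm.min measurable_const).pow_const α)]
  · exact iSup_le key
  · intro n m hnm y
    exact ENNReal.rpow_le_rpow (min_le_min_left _ (by exact_mod_cast hnm)) hα0.le

/-! ### From Rényi divergence to approximate differential privacy -/

/-- The line `x - y`, of slope one, touches `c x ^ α` from below for this choice of `c`. -/
theorem le_add_mul_rpow (hα : 1 < α) {x y : ℝ} (hx : 0 ≤ x) (hy : 0 < y) :
    x ≤ y + y ^ (1 - α) * ((α - 1) / α) ^ (α - 1) / α * x ^ α := by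
  have hα0 : 0 < α := by linarith
  have hα1 : 0 < α - 1 := by linarith
  -- Bernoulli's inequality at the ratio of `x` to the point of tangency `y α / (α - 1)`.
  set z := x * (α - 1) / (y * α) with hz
  have hz0 : 0 ≤ z := by positivity
  have hb := one_add_mul_self_le_rpow_one_add (s := z - 1) (by linarith) hα.le
  rw [add_sub_cancel] at hb
  have hxz : x = z * (y * α / (α - 1)) := by rw [hz]; field_simp
  have hc : y ^ (1 - α) * ((α - 1) / α) ^ (α - 1) / α * x ^ α = y / (α - 1) * z ^ α := by
    rw [hxz, Real.mul_rpow hz0 (by positivity),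
      show y * α / (α - 1) = y * ((α - 1) / α)⁻¹ by field_simp,
      Real.mul_rpow hy.le (by positivity), Real.inv_rpow (by positivity),
      Real.rpow_sub hy, Real.rpow_one, Real.rpow_sub (by positivity : 0 < (α - 1) / α),
      Real.rpow_one]
    have h1 : y ^ α ≠ 0 := (Real.rpow_pos_of_pos hy _).ne'
    have h2 : ((α - 1) / α) ^ α ≠ 0 := (Real.rpow_pos_of_pos (by positivity) _).ne'
    field_simp
  rw [hc]
  have h3 : y / (α - 1) * (1 + α * (z - 1)) ≤ y / (α - 1) * z ^ α := by gcongr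
  have h4 : x = y + y / (α - 1) * (1 + α * (z - 1)) := by rw [hxz]; field_simp; ring
  linarith

/-- A bound `ρ` on the Rényi divergence of order `α` gives `(ε, δ)`-indistinguishability. -/
theorem RenyiBound.measure_le [IsProbabilityMeasure P] [IsProbabilityMeasure Q] (hα : 1 < α)
    (h : RenyiBound α ρ P Q) {δ ε : ℝ} (hδ : 0 < δ)
    (hε : ε = ρ + Real.log ((α - 1) / α) - (Real.log δ + Real.log α) / (α - 1)) (A : Set Z) :
    P A ≤ ENNReal.ofReal (Real.exp ε) * Q A + ENNReal.ofReal δ := by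
  have hα0 : 0 < α := by linarith
  have hα1 : 0 < α - 1 := by linarith
  set c := Real.exp ε ^ (1 - α) * ((α - 1) / α) ^ (α - 1) / α with hc
  have hc0 : 0 < c := by
    have := Real.rpow_pos_of_pos (Real.exp_pos ε) (1 - α)
    have := Real.rpow_pos_of_pos (show 0 < (α - 1) / α by positivity) (α - 1)
    positivity
  have hcδ : c * Real.exp ((α - 1) * ρ) = δ := by
    rw [hc, ← Real.exp_mul, Real.rpow_def_of_pos (by positivity : 0 < (α - 1) / α)]
    conv_lhs => rw [← Real.exp_log hα0]
    rw [← Real.exp_add, ← Real.exp_sub, ← Real.exp_add, Real.exp_log hα0]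
    conv_rhs => rw [← Real.exp_log hδ]
    congr 1
    rw [hε]
    field_simp
    ring
  have hpt : ∀ t : ℝ≥0∞,
      t ≤ ENNReal.ofReal (Real.exp ε) + ENNReal.ofReal c * t ^ α := by
    intro t
    rcases eq_or_ne t ∞ with rfl | ht
    · simp [ENNReal.top_rpow_of_pos hα0, ENNReal.mul_top, hc0]
    · lift t to NNReal using ht
      have := le_add_mul_rpow hα t.2 (Real.exp_pos ε)
      rw [← hc] at this
      have h2 := ENNReal.ofReal_le_ofReal this
      have h3 : 0 ≤ (t : ℝ) ^ α := Real.rpow_nonneg t.2 _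
      rw [ENNReal.ofReal_add (Real.exp_pos ε).le (by positivity), ENNReal.ofReal_mul hc0.le,
        ← ENNReal.ofReal_rpow_of_nonneg t.2 hα0.le] at h2
      simpa using h2
  calc P A = ∫⁻ x in A, P.rnDeriv Q x ∂Q := (Measure.setLIntegral_rnDeriv h.ac A).symm
    _ ≤ ∫⁻ x in A, (ENNReal.ofReal (Real.exp ε) + ENNReal.ofReal c * (P.rnDeriv Q x) ^ α) ∂Q :=
        lintegral_mono fun x => hpt _
    _ = ENNReal.ofReal (Real.exp ε) * Q A +
          ENNReal.ofReal c * ∫⁻ x in A, (P.rnDeriv Q x) ^ α ∂Q := by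
        rw [lintegral_add_left measurable_const, setLIntegral_const,
          lintegral_const_mul _ (by fun_prop)]
    _ ≤ ENNReal.ofReal (Real.exp ε) * Q A +
          ENNReal.ofReal c * ENNReal.ofReal (Real.exp ((α - 1) * ρ)) := by
        gcongr
        exact (setLIntegral_le_lintegral _ _).trans h.lintegral_le
    _ = ENNReal.ofReal (Real.exp ε) * Q A + ENNReal.ofReal δ := by
        rw [← ENNReal.ofReal_mul hc0.le, hcδ]

end

section

/-! ### The algorithm as a post-processing of the transcript of one silo -/
theorem measurable_update_snd {S β : Type*} [DecidableEq S] [MeasurableSpace β] (s₀ : S) :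
    Measurable fun p : β × (S → β) => Function.update p.2 s₀ p.1 := by
  refine measurable_pi_iff.2 fun s => ?_
  rcases eq_or_ne s s₀ with rfl | hs
  · simpa using measurable_fst
  · simp only [Function.update_of_ne hs]
    fun_prop

theorem lintegral_map_id_prod {Y Y' Z : Type*} [MeasurableSpace Y] [MeasurableSpace Y']
    [MeasurableSpace Z] (κ : Kernel Y Y') [IsSFiniteKernel κ] {g : Y × Y' → Z}
    (hg : Measurable g) {φ : Z → ℝ≥0∞} (hφ : Measurable φ) (y : Y) :
    ∫⁻ z, φ z ∂((Kernel.id ×ₖ κ).map g y) = ∫⁻ c, φ (g (y, c)) ∂(κ y) := by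
  have h : Measurable fun q => φ (g q) := hφ.comp hg
  rw [Kernel.lintegral_map _ hg _ hφ, Kernel.lintegral_prod _ _ _ h, Kernel.id_apply,
    lintegral_dirac' _ (f := fun b => ∫⁻ c, φ (g (b, c)) ∂(κ y)) h.lintegral_prod_right']

open Classical in
/-- Resampling one coordinate of a product law. -/
theorem pi_eq_map_update {S β : Type*} [Fintype S] [MeasurableSpace β]
    (μ ν : S → Measure β) [∀ s, IsProbabilityMeasure (μ s)] [∀ s, IsProbabilityMeasure (ν s)]
    (s₀ : S) (h : ∀ s ≠ s₀, μ s = ν s) :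
    Measure.pi ν = ((ν s₀).prod (Measure.pi μ)).map fun p => Function.update p.2 s₀ p.1 := by
  have hm := measurable_update_snd (β := β) s₀
  refine Measure.pi_eq fun t ht => ?_
  rw [Measure.map_apply hm (MeasurableSet.univ_pi ht)]
  have hpre : (fun p : β × (S → β) => Function.update p.2 s₀ p.1) ⁻¹' Set.univ.pi t
      = t s₀ ×ˢ Set.univ.pi (Function.update t s₀ Set.univ) := by
    ext ⟨x, q⟩
    simp only [Set.mem_preimage, Set.mem_pi, Set.mem_univ, true_implies, Set.mem_prod]
    constructor
    · intro hq
      refine ⟨by simpa using hq s₀, fun s => ?_⟩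
      rcases eq_or_ne s s₀ with rfl | hs
      · simp
      · simpa [Function.update_of_ne hs] using hq s
    · rintro ⟨hx, hq⟩ s
      rcases eq_or_ne s s₀ with rfl | hs
      · simpa using hx
      · simpa [Function.update_of_ne hs] using hq s
  rw [hpre, Measure.prod_prod, Measure.pi_pi,
    ← Finset.mul_prod_erase Finset.univ (fun s => ν s (t s)) (Finset.mem_univ s₀),
    ← Finset.mul_prod_erase Finset.univ _ (Finset.mem_univ s₀)]
  simp only [Function.update_self, measure_univ, one_mul]
  congr 1
  refine Finset.prod_congr rfl fun s hs => ?_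
  rw [Function.update_of_ne (Finset.ne_of_mem_erase hs), h s (Finset.ne_of_mem_erase hs)]

variable {d : ℕ} {S U X : Type*} [Fintype S] [Fintype U] {m : ℕ} (F : Model d → X → ℝ)
  (P : S → SGDParams) (ηg : ℝ) (b : S → U → Fin m → Bool) (μ₀ : Measure (Model d))

open Classical in
/-- The aggregation step seen from the silo `s₀`: for the model `p.1` at the start of the round
and the output `p.2` of the local subroutine of `s₀`, the server's next model is
`p.1 + ηg (1 / |S|) ∑ s, Δ s`, where `Δ s₀ = p.2 - p.1` and the other silos run their procedure on
`D`. The draw of the procedure of `s₀` itself on `D s₀` is discarded. -/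
noncomputable def aggregate (D : Database S U m X) (s₀ : S) :
    Kernel (Model d × Model d) (Model d) :=
  (Kernel.id ×ₖ (piKernel fun s => client F (P s) (b s) (D s)).comap Prod.fst
      measurable_fst).map fun q =>
    q.1.1 + ηg • (Fintype.card S : ℝ)⁻¹ • ∑ s, Function.update q.2 s₀ (q.1.2 - q.1.1) s

theorem measurable_aggregate_update [DecidableEq S] (s₀ : S) :
    Measurable fun q : (Model d × Model d) × (S → Model d) =>
      q.1.1 + ηg • (Fintype.card S : ℝ)⁻¹ • ∑ s, Function.update q.2 s₀ (q.1.2 - q.1.1) s := by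
  have h : Measurable fun q : (Model d × Model d) × (S → Model d) =>
      Function.update q.2 s₀ (q.1.2 - q.1.1) :=
    (measurable_update_snd s₀).comp
      (by fun_prop : Measurable fun q : (Model d × Model d) × (S → Model d) =>
        (q.1.2 - q.1.1, q.2))
  fun_prop

instance (D : Database S U m X) (s₀ : S) : IsMarkovKernel (aggregate F P ηg b D s₀) :=
  Kernel.IsMarkovKernel.map _ (by classical exact measurable_aggregate_update ηg s₀)

theorem client_congr {b : U → Fin m → Bool} {D D' : SiloData U m X} (P : SGDParams)
    (h : filterData b D = filterData b D') : client F P b D = client F P b D' := by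
  unfold client; rw [h]

theorem uldpGroup_congr {D D' : Database S U m X}
    (h : ∀ s, filterData (b s) (D s) = filterData (b s) (D' s)) (T : ℕ) :
    uldpGroup F P ηg b μ₀ D T = uldpGroup F P ηg b μ₀ D' T := by
  have hr : round F P ηg b D = round F P ηg b D' := by
    have : (piKernel fun s => client F (P s) (b s) (D s))
        = piKernel fun s => client F (P s) (b s) (D' s) := by
      ext1 a
      show Measure.pi _ = Measure.pi _
      simp_rw [fun s => client_congr F (P s) (h s)]
    unfold round
    rw [this]
  induction T with
  | zero => rfl
  | succ T ih => simp only [uldpGroup, ih, hr]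

/-- A round consists of a call of the local subroutine of the silo `s₀`, followed by an
aggregation that does not look at the data of `s₀`: it may be run with any database that agrees
with `D'` on the flagged records of the other silos. -/
theorem lintegral_round {D D' : Database S U m X} (s₀ : S)
    (h : ∀ s ≠ s₀, filterData (b s) (D s) = filterData (b s) (D' s)) (θ : Model d)
    {φ : Model d → ℝ≥0∞} (hφ : Measurable φ) :
    ∫⁻ y, φ y ∂(round F P ηg b D' θ) =
      ∫⁻ x, ∫⁻ y, φ y ∂(aggregate F P ηg b D s₀ (θ, x))
        ∂(dpsgd F (P s₀) (filterData (b s₀) (D' s₀)) θ) := by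
  classical
  have hpi : (piKernel fun s => client F (P s) (b s) (D' s)) θ =
      ((client F (P s₀) (b s₀) (D' s₀) θ).prod
        ((piKernel fun s => client F (P s) (b s) (D s)) θ)).map
          fun p => Function.update p.2 s₀ p.1 :=
    pi_eq_map_update _ (fun s => client F (P s) (b s) (D' s) θ) s₀
      fun s hs => by simp only [client_congr F (P s) (h s hs)]
  have hm : Measurable fun p : Model d × (S → Model d) => Function.update p.2 s₀ p.1 :=
    measurable_update_snd s₀
  have hg : Measurable fun q : Model d × (S → Model d) =>
      q.1 + ηg • (Fintype.card S : ℝ)⁻¹ • ∑ s, q.2 s := by fun_prop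
  have ha := measurable_aggregate_update (d := d) ηg s₀
  have hg2 : Measurable fun c : S → Model d =>
      φ (θ + ηg • (Fintype.card S : ℝ)⁻¹ • ∑ s, c s) := hφ.comp (by fun_prop)
  have hg3 : Measurable fun p : Model d × (S → Model d) =>
      φ (θ + ηg • (Fintype.card S : ℝ)⁻¹ • ∑ s, Function.update p.2 s₀ p.1 s) := hg2.comp hm
  have hg4 : Measurable fun x : Model d => ∫⁻ c, φ (θ + ηg • (Fintype.card S : ℝ)⁻¹ •
      ∑ s, Function.update c s₀ x s) ∂((piKernel fun s => client F (P s) (b s) (D s)) θ) :=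
    hg3.lintegral_prod_right'
  have hagg : ∀ x : Model d, ∫⁻ y, φ y ∂(aggregate F P ηg b D s₀ (θ, x)) =
      ∫⁻ c, φ (θ + ηg • (Fintype.card S : ℝ)⁻¹ • ∑ s, Function.update c s₀ (x - θ) s)
        ∂((piKernel fun s => client F (P s) (b s) (D s)) θ) :=
    fun x => lintegral_map_id_prod _ ha hφ (θ, x)
  simp_rw [hagg]
  unfold round
  rw [lintegral_map_id_prod _ hg hφ, hpi, lintegral_map hg2 hm,
    lintegral_prod _ hg3.aemeasurable]
  exact lintegral_map_id_prod _ (by fun_prop) hg4 θ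

/-- The rule by which the initial models of the calls of the silo `s₀` arise in the algorithm. -/
noncomputable def groupRule (D : Database S U m X) (s₀ : S) : Rule (Model d)
  | 0 => Kernel.const _ μ₀
  | t + 1 => (aggregate F P ηg b D s₀).comap
      (fun h : Fin (t + 1) → Model d × Model d => h (Fin.last t)) (measurable_pi_apply _)

instance [IsProbabilityMeasure μ₀] (D : Database S U m X) (s₀ : S) (t : ℕ) :
    IsMarkovKernel (groupRule F P ηg b μ₀ D s₀ t) := by
  cases t <;> (unfold groupRule; infer_instance)

theorem measurable_snoc_fst {E : Type*} [MeasurableSpace E] (T : ℕ) :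
    Measurable fun p : (Fin T → E × E) × E =>
      (Fin.snoc (fun i => (p.1 i).1) p.2 : Fin (T + 1) → E) :=
  (measurable_fin_snoc T).comp
    (by fun_prop : Measurable fun p : (Fin T → E × E) × E => (fun i => (p.1 i).1, p.2))

/-- The global models `θ 0, …, θ T` are the initial models of the `T` calls of the silo `s₀`,
followed by the model that the rule would choose for a further call. -/
theorem uldpGroup_eq_map_transcript [IsProbabilityMeasure μ₀] {D D' : Database S U m X} (s₀ : S)
    (h : ∀ s ≠ s₀, filterData (b s) (D s) = filterData (b s) (D' s)) (T : ℕ) :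
    uldpGroup F P ηg b μ₀ D' T =
      (transcript (groupRule F P ηg b μ₀ D s₀) (dpsgd F (P s₀) (filterData (b s₀) (D' s₀))) T ⊗ₘ
        groupRule F P ηg b μ₀ D s₀ T).map
          fun p => (Fin.snoc (fun i => (p.1 i).1) p.2 : Fin (T + 1) → Model d) := by
  induction T with
  | zero =>
    refine Measure.ext_of_lintegral _ fun φ hφ => ?_
    have hm : Measurable fun p : (Fin 0 → Model d × Model d) × Model d =>
        φ (Fin.snoc (fun i => (p.1 i).1) p.2) := hφ.comp (measurable_snoc_fst 0)
    have hm0 : Measurable fun (θ : Model d) (_ : Fin (0 + 1)) => θ := by fun_prop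
    rw [lintegral_map hφ (measurable_snoc_fst 0), Measure.lintegral_compProd hm]
    simp only [uldpGroup, transcript, groupRule, Kernel.const_apply]
    rw [lintegral_map hφ hm0, lintegral_dirac' _ (Measurable.lintegral_prod_right' hm)]
    refine lintegral_congr fun θ => ?_
    congr 1
  | succ T ih =>
    refine Measure.ext_of_lintegral _ fun φ hφ => ?_
    have hm1 := measurable_fin_snoc (E := Model d) (T + 1)
    have hm2 := measurable_snoc_fst (E := Model d) T
    have hm3 := measurable_snoc_fst (E := Model d) (T + 1)
    have hm4 := measurable_fin_snoc (E := Model d × Model d) T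
    have hφ1 : Measurable fun p : (Fin (T + 1) → Model d) × Model d =>
        φ (Fin.snoc p.1 p.2) := hφ.comp hm1
    have hφ3 : Measurable fun p : (Fin (T + 1) → Model d × Model d) × Model d =>
        φ (Fin.snoc (fun i => (p.1 i).1) p.2) := hφ.comp hm3
    have hφ4 : Measurable fun h : Fin (T + 1) → Model d × Model d =>
        ∫⁻ θ', φ (Fin.snoc (fun i => (h i).1) θ') ∂(groupRule F P ηg b μ₀ D s₀ (T + 1) h) :=
      hφ3.lintegral_kernel_prod_right'
    have hφ2 : Measurable fun h : Fin (T + 1) → Model d =>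
        ∫⁻ θ', φ (Fin.snoc h θ') ∂(round F P ηg b D' (h (Fin.last T))) :=
      hφ1.lintegral_kernel_prod_right' (κ := (round F P ηg b D').comap
        (fun h : Fin (T + 1) → Model d => h (Fin.last T)) (measurable_pi_apply _))
    have hφ6 : Measurable fun p : (Fin T → Model d × Model d) × Model d =>
        ∫⁻ θ', φ (Fin.snoc (Fin.snoc (fun i => (p.1 i).1) p.2 : Fin (T + 1) → Model d) θ')
          ∂(round F P ηg b D' ((Fin.snoc (fun i => (p.1 i).1) p.2 : Fin (T + 1) → Model d)
            (Fin.last T))) := hφ2.comp hm2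
    have hφ5 : Measurable fun p : (Fin T → Model d × Model d) × (Model d × Model d) =>
        ∫⁻ θ', φ (Fin.snoc (fun i => ((Fin.snoc p.1 p.2 : Fin (T + 1) → Model d × Model d) i).1)
          θ') ∂(groupRule F P ηg b μ₀ D s₀ (T + 1) (Fin.snoc p.1 p.2)) := hφ4.comp hm4
    rw [lintegral_map hφ hm3, Measure.lintegral_compProd hφ3]
    simp only [uldpGroup]
    rw [lintegral_map hφ hm1, Measure.lintegral_compProd hφ1, ih]
    simp only [Kernel.comap_apply, transcript]
    rw [lintegral_map hφ2 hm2, Measure.lintegral_compProd hφ6,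
      lintegral_map hφ4 hm4, Measure.lintegral_compProd hφ5]
    refine lintegral_congr fun h' => ?_
    refine Eq.trans ?_ (Kernel.lintegral_compProd _ _ _
      (hφ5.comp (by fun_prop : Measurable fun q => (h', q)))).symm
    refine lintegral_congr fun θ => ?_
    simp only [Function.comp_apply, Fin.snoc_last, Kernel.prodMkLeft_apply]
    refine (lintegral_round F P ηg b s₀ h θ
      (hφ1.comp (measurable_prodMk_left (x := Fin.snoc (fun i => (h' i).1) θ)))).trans ?_
    refine lintegral_congr fun x => ?_
    simp only [groupRule, Kernel.comap_apply, Fin.snoc_last]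
    refine lintegral_congr fun y => ?_
    show φ (Fin.snoc (Fin.snoc (fun i => (h' i).1) θ) y) = _
    congr 2
    ext1 i
    induction i using Fin.lastCases <;> simp

end

section

/-! ### Group privacy -/

variable {d : ℕ} {S U X : Type*} [Fintype S] [Fintype U] {m : ℕ} {F : Model d → X → ℝ}
  {P : S → SGDParams} {ηg : ℝ} {b : S → U → Fin m → Bool} {μ₀ : Measure (Model d)}
  [IsProbabilityMeasure μ₀] {T : ℕ} {α ρ : ℝ}

/-- If the filtered databases differ in a single record, then the Rényi bound of the local
subroutine of the silo holding that record is inherited by the global models. -/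
theorem RenyiBound.uldpGroup_of_recordNeighbor (hα : 1 < α) {D D' : Database S U m X} (s₀ : S)
    (hρ : LocalDPSGDIsRDP U m F (P s₀) T α ρ)
    (hne : ∀ s ≠ s₀, filterData (b s) (D s) = filterData (b s) (D' s))
    (hnbr : RecordNeighbor (filterData (b s₀) (D s₀)) (filterData (b s₀) (D' s₀))) :
    RenyiBound α ρ (uldpGroup F P ηg b μ₀ D T) (uldpGroup F P ηg b μ₀ D' T) := by
  have h := RenyiBound.of_renyiDiv_le hα (hρ (groupRule F P ηg b μ₀ D s₀) _ _ hnbr)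
  have hm := measurable_snoc_fst (E := Model d) T
  rw [uldpGroup_eq_map_transcript F P ηg b μ₀ (D := D) (D' := D) s₀ (fun _ _ => rfl) T,
    uldpGroup_eq_map_transcript F P ηg b μ₀ s₀ hne T, Measure.compProd_eq_comp_prod,
    Measure.compProd_eq_comp_prod, ← Measure.deterministic_comp_eq_map hm,
    ← Measure.deterministic_comp_eq_map hm]
  exact (h.comp _ hα).comp _ hα

theorem LocalDPSGDIsRDP.nonneg (hα : 1 < α) {P : SGDParams}
    (hρ : LocalDPSGDIsRDP U m F P T α ρ) (D : SiloData U m X) : 0 ≤ ρ := by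
  have hD : RecordNeighbor D D := fun p hp => absurd rfl hp
  exact RenyiBound.nonneg_of_self hα
    (RenyiBound.of_renyiDiv_le hα (hρ (fun _ => Kernel.const _ (Measure.dirac 0)) D D hD))

open Classical in
/-- The database `D` with the records of the user `u` in the places `W` replaced by those
of `D'`. -/
noncomputable def hybrid (D D' : Database S U m X) (u : U) (W : Finset (S × Fin m)) : Database S U m X :=
  fun s v i => if v = u ∧ (s, i) ∈ W then D' s v i else D s v i

/-- Replacing the records of one user one at a time: every replacement halves the order and at
most triples the bound. -/
theorem RenyiBound.uldpGroup_hybrid (hρ0 : 0 ≤ ρ)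
    (hρ : ∀ s, LocalDPSGDIsRDP U m F (P s) T α ρ) (D D' : Database S U m X) (u : U)
    (W : Finset (S × Fin m)) (hα : 2 ^ (W.card + 1) ≤ α) :
    RenyiBound (α / 2 ^ W.card) (3 ^ W.card * ρ) (uldpGroup F P ηg b μ₀ D T)
      (uldpGroup F P ηg b μ₀ (hybrid D D' u W) T) := by
  classical
  induction W using Finset.induction_on with
  | empty =>
    have h0 : hybrid D D' u ∅ = D := by
      funext s v i
      simp [hybrid]
    rw [h0]
    have hα' : (1 : ℝ) ≤ α := by
      simp only [Finset.card_empty, zero_add, pow_one] at hα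
      linarith
    simpa using RenyiBound.refl hα' hρ0 _
  | insert a W ha ih =>
    rw [Finset.card_insert_of_notMem ha] at hα ⊢
    set n := W.card with hn
    have hpow : (0 : ℝ) < 2 ^ n := by positivity
    have hpow1 : (1 : ℝ) ≤ 2 ^ n := one_le_pow₀ (by norm_num)
    have h4 : 4 * 2 ^ n ≤ α := by rw [pow_succ, pow_succ] at hα; linarith
    have hβ : 2 ≤ α / 2 ^ (n + 1) := by
      rw [le_div_iff₀ (by positivity), pow_succ]
      linarith
    have hβ2 : 2 * (α / 2 ^ (n + 1)) = α / 2 ^ n := by rw [pow_succ]; field_simp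
    have h1 := ih (by rw [pow_succ]; linarith)
    rw [← hβ2] at h1
    have hsame : ∀ s v i, ¬ (v = u ∧ (s, i) = a) →
        hybrid D D' u W s v i = hybrid D D' u (insert a W) s v i := by
      intro s v i h
      unfold hybrid
      by_cases hv : v = u
      · have : (s, i) ≠ a := fun h' => h ⟨hv, h'⟩
        simp [hv, this]
      · simp [hv]
    have h2 : RenyiBound α ρ (uldpGroup F P ηg b μ₀ (hybrid D D' u W) T)
        (uldpGroup F P ηg b μ₀ (hybrid D D' u (insert a W)) T) := by
      refine RenyiBound.uldpGroup_of_recordNeighbor (by linarith) a.1 (hρ a.1) ?_ ?_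
      · intro s hs
        have h : hybrid D D' u W s = hybrid D D' u (insert a W) s := by
          funext v i
          exact hsame s v i fun h => hs (congrArg Prod.fst h.2)
        rw [h]
      · have h : ∀ p : U × Fin m, filterData (b a.1) (hybrid D D' u W a.1) p.1 p.2 ≠
            filterData (b a.1) (hybrid D D' u (insert a W) a.1) p.1 p.2 → p = (u, a.2) := by
          intro p hp
          by_contra hne
          refine hp ?_
          unfold filterData
          rw [hsame a.1 p.1 p.2 fun h =>
            hne (Prod.ext h.1 (congrArg (fun q : S × Fin m => q.2) h.2))]
        exact fun p hp q hq => (h p hp).trans (h q hq).symm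
    have h2' := h2.mono_order (β := 2 * (α / 2 ^ (n + 1))) (by linarith)
      (by rw [hβ2]; exact div_le_self (by linarith) hpow1) (by linarith)
    refine (RenyiBound.trans hβ (by positivity) h1 h2').mono_right (by linarith) ?_
    have h3 : ρ ≤ 3 ^ n * ρ := le_mul_of_one_le_left hρ0 (one_le_pow₀ (by norm_num))
    rw [pow_succ]
    linarith

/-- Group privacy: if every user has at most `k` flagged records, the global models for
user-neighbouring databases are close in Rényi divergence. -/
theorem RenyiBound.uldpGroup_of_userNeighbor {k : ℕ} (hb : ∀ u, ∑ s, ∑ i, (b s u i).toNat ≤ k)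
    (hα : 2 ^ (k + 1) < α) (hρ0 : 0 ≤ ρ) (hρ : ∀ s, LocalDPSGDIsRDP U m F (P s) T α ρ)
    {D D' : Database S U m X} (hD : UserNeighbor D D') :
    RenyiBound (α / 2 ^ k) (3 ^ k * ρ) (uldpGroup F P ηg b μ₀ D T)
      (uldpGroup F P ηg b μ₀ D' T) := by
  classical
  have hβ : 2 < α / 2 ^ k := by
    rw [lt_div_iff₀ (by positivity)]
    rw [pow_succ] at hα
    linarith
  by_cases hu : ∃ u, ∃ s, D s u ≠ D' s u
  · obtain ⟨u, hu⟩ := hu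
    -- Only the flagged records of the user `u` have to be replaced.
    set W : Finset (S × Fin m) := Finset.univ.filter fun p => b p.1 u p.2 = true with hW
    have hcard : W.card ≤ k := by
      refine le_trans (le_of_eq ?_) (hb u)
      rw [hW, Finset.card_filter, Fintype.sum_prod_type]
      refine Finset.sum_congr rfl fun s _ => Finset.sum_congr rfl fun i _ => ?_
      cases b s u i <;> rfl
    have hpow : (2 : ℝ) ^ W.card ≤ 2 ^ k := pow_le_pow_right₀ (by norm_num) hcard
    have h1 := RenyiBound.uldpGroup_hybrid (ηg := ηg) (b := b) (μ₀ := μ₀) hρ0 hρ D D' u W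
      (le_trans (pow_le_pow_right₀ (by norm_num) (by omega)) hα.le)
    have hα0 : 0 ≤ α := le_trans (by positivity) hα.le
    have hle : α / 2 ^ k ≤ α / 2 ^ W.card := div_le_div_of_nonneg_left hα0 (by positivity) hpow
    have h2 := (h1.mono_order (by linarith) hle (by linarith)).mono_right (by linarith)
      (mul_le_mul_of_nonneg_right (pow_le_pow_right₀ (by norm_num : (1 : ℝ) ≤ 3) hcard) hρ0)
    have h3 : ∀ s, filterData (b s) (hybrid D D' u W s) = filterData (b s) (D' s) := by
      intro s
      funext v i
      unfold filterData hybrid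
      by_cases hbv : b s v i = true
      · by_cases hv : v = u
        · subst hv
          simp [hW, hbv]
        · have : D s v = D' s v := by
            by_contra hne
            exact hv (hD ⟨s, hne⟩ hu)
          simp [hv, this]
      · simp [hbv]
    rwa [uldpGroup_congr F P ηg b μ₀ h3] at h2
  · push Not at hu
    have : D = D' := funext fun s => funext fun u => hu u s
    rw [this]
    exact RenyiBound.refl (by linarith) (by positivity) _

end

end ULDP

theorem theorem2 {S U X : Type*} [Fintype S] [Nonempty S] [Fintype U] (m d : ℕ)
    (F : ULDP.Model d → X → ℝ) (P : S → ULDP.SGDParams) (ηg : ℝ) (T : ℕ)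
    (μ₀ : Measure (ULDP.Model d)) [IsProbabilityMeasure μ₀]
    (k : ℕ) (hk : ∃ c : ℕ, k = 2 ^ c)
    (b : S → U → Fin m → Bool) (hb : ∀ u, ∑ s, ∑ i, (b s u i).toNat ≤ k)
    (α δ : ℝ) (hα : (2 : ℝ) ^ (k + 1) < α) (hδ0 : 0 < δ) (hδ1 : δ < 1)
    (ρ : S → ℝ) (hρ : ∀ s, ULDP.LocalDPSGDIsRDP U m F (P s) T α (ρ s))
    (ε : ℝ)
    (hε : ε = 3 ^ k * Finset.univ.sup' Finset.univ_nonempty ρ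
      + Real.log ((α / 2 ^ k - 1) / (α / 2 ^ k))
      - (Real.log δ + Real.log (α / 2 ^ k)) / (α / 2 ^ k - 1)) :
    ULDP.IsULDP (fun D : ULDP.Database S U m X => ULDP.uldpGroup F P ηg b μ₀ D T) ε δ ∧
      ULDP.IsULDP (ULDP.uldpGroupFinal F P ηg b μ₀ T) ε δ := by
  have hpow : (1 : ℝ) ≤ 2 ^ k := one_le_pow₀ (by norm_num)
  have hβ : 2 < α / 2 ^ k := by
    rw [lt_div_iff₀ (by positivity)]
    rw [pow_succ] at hα
    linarith
  have hα1 : 1 < α := by rw [pow_succ] at hα; linarith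
  set ρmax := Finset.univ.sup' Finset.univ_nonempty ρ with hρmax
  have hle : ∀ s, ρ s ≤ ρmax := fun s => Finset.le_sup' ρ (Finset.mem_univ s)
  have hloc : ∀ s, ULDP.LocalDPSGDIsRDP U m F (P s) T α ρmax := fun s A _ D D' hD =>
    (hρ s A D D' hD).trans (EReal.coe_le_coe_iff.2 (hle s))
  have hseq : ∀ D D' : ULDP.Database S U m X, ULDP.UserNeighbor D D' →
      ∀ A : Set (Fin (T + 1) → ULDP.Model d),
        ULDP.uldpGroup F P ηg b μ₀ D T A ≤
          ENNReal.ofReal (Real.exp ε) * ULDP.uldpGroup F P ηg b μ₀ D' T A + ENNReal.ofReal δ := by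
    intro D D' hD A
    obtain ⟨s⟩ := ‹Nonempty S›
    have hρ0 : 0 ≤ ρmax := (hloc s).nonneg hα1 (D s)
    exact (ULDP.RenyiBound.uldpGroup_of_userNeighbor hb hα hρ0 hloc hD).measure_le
      (by linarith) hδ0 hε A
  refine ⟨fun D D' hD A _ => hseq D D' hD A, fun D D' hD A hA => ?_⟩
  have hm : Measurable fun h : Fin (T + 1) → ULDP.Model d => h (Fin.last T) :=
    measurable_pi_apply _
  rw [ULDP.uldpGroupFinal, ULDP.uldpGroupFinal, Measure.map_apply hm hA, Measure.map_apply hm hA]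
  exact hseq D D' hD _
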